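/- Let $q$ be a prime power and let $X\subseteq\mathbb{P}^2$ be the Hermitian curve $y^qz+yz^q=x^{q+1}$ over $\mathbb{F}_{q^2}$, with point at infinity $P_\infty=(0:1:0)$. Put $B:=X(\mathbb{F}_{q^2})\setminus\{P_\infty\}$. Let $d,a$ be integers with $0<d<q$ and $1\le a\le d$, and let $H\subseteq B$ be a nonempty subset. Let $C(d,a,H)\subseteq\mathbb{F}_{q^2}^{B\setminus H}$ be the code obtained by evaluating, at the points of $B\setminus H$ (in coordinates $(x:y:1)$), the space $H^0(X,\mathcal{O}_X(d)(-aP_\infty))$ of the degree $d$ homogeneous forms on $X$ that vanish on the scheme $aP_\infty$ (the closed subscheme of $X$ defined by the $a$-th power of the ideal sheaf of $P_\infty$). Let $C(d,a,H)^\perp$ be its dual code with respect to the standard product $v\cdot w=\sum_i v_iw_i$. The minimum distance of a code is the least Hamming distance between two distinct codewords, and is $\infty$ for the zero code. Then the minimum distance of $C(d,a,H)^\perp$ is at least $d+1$, and it equals $d+1$ if and only if there exist $d+1$ distinct points of $B\setminus H$ lying on a common line of $\mathbb{P}^2$ through $P_\infty$. -/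

import Mathlib

open MvPolynomial
open scoped LinearAlgebra.Projectivization

namespace HermitianCode

section Codes

variable {K ι : Type*} [Field K] [Fintype ι]

/-- The minimum distance of a code: the least Hamming distance of two distinct codewords;
it is `⊤` for the zero code. -/
noncomputable def minDist [DecidableEq K] (C : Submodule K (ι → K)) : ℕ∞ :=
  ⨅ (v ∈ C) (w ∈ C) (_ : v ≠ w), (hammingDist v w : ℕ∞)

/-- The dual code, for the standard product `v ⬝ᵥ c = ∑ i, v i * c i`. -/
def dualCode (C : Submodule K (ι → K)) : Submodule K (ι → K) where
  carrier := {v | ∀ c ∈ C, v ⬝ᵥ c = 0}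
  zero_mem' := fun c _ => zero_dotProduct c
  add_mem' := fun hv hw c hc => by rw [add_dotProduct, hv c hc, hw c hc, add_zero]
  smul_mem' := fun r v hv c hc => by rw [smul_dotProduct, hv c hc, smul_zero]

end Codes

section Curve

variable (q : ℕ) (K : Type*) [Field K]

/-- The homogeneous equation `y ^ q * z + y * z ^ q - x ^ (q + 1)` of the Hermitian curve `X`,
with `x, y, z` the variables `0, 1, 2`. -/
noncomputable def hermitianPoly : MvPolynomial (Fin 3) K :=
  X 1 ^ q * X 2 + X 1 * X 2 ^ q - X 0 ^ (q + 1)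

/-- The `K`-rational points of `X`. -/
def rationalPoints : Set (ℙ K (Fin 3 → K)) :=
  {P | eval P.rep (hermitianPoly q K) = 0}

/-- The point at infinity `(0 : 1 : 0)`. -/
def pInf : ℙ K (Fin 3 → K) :=
  Projectivization.mk K ![0, 1, 0] (fun h => one_ne_zero (congrFun h 1))

/-- The set `B` of the `K`-rational points of `X` other than the point at infinity. -/
def affinePoints : Set (ℙ K (Fin 3 → K)) :=
  rationalPoints q K \ {pInf K}

variable {K} in
/-- The line of the projective plane with equation `l * x + m * y + n * z = 0`, where
`L = (l : m : n)`. -/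
def line (L : ℙ K (Fin 3 → K)) : Set (ℙ K (Fin 3 → K)) :=
  {P | P.orthogonal L}

/-- The homogeneous coordinate ring `K[x, y, z] / (y ^ q z + y z ^ q - x ^ (q + 1))` of `X`. -/
abbrev CoordRing : Type _ :=
  MvPolynomial (Fin 3) K ⧸ Ideal.span {hermitianPoly q K}

/-- The space `H⁰(X, 𝒪_X(d))` of the degree `d` homogeneous forms on `X`. -/
noncomputable def formsOn (d : ℕ) : Submodule K (CoordRing q K) :=
  (homogeneousSubmodule (Fin 3) K d).map
    (Ideal.Quotient.mkₐ K (Ideal.span {hermitianPoly q K})).toLinearMap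

/-- Setting `y = 1`: the passage to the affine chart `y ≠ 0`, with coordinates `u = x / y` and
`w = z / y` (the variables `0, 1`). The point at infinity is the origin of this chart. -/
noncomputable def dehomogenize : MvPolynomial (Fin 3) K →ₐ[K] MvPolynomial (Fin 2) K :=
  aeval ![X 0, 1, X 1]

/-- The coordinate ring of the affine curve `X ∩ {y ≠ 0}`. -/
abbrev ChartRing : Type _ :=
  MvPolynomial (Fin 2) K ⧸ Ideal.span {dehomogenize K (hermitianPoly q K)}

/-- Restriction of forms on `X` to the chart `y ≠ 0`, trivializing `𝒪_X(d)` there by `y ^ d`. -/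
noncomputable def toChart : CoordRing q K →ₐ[K] ChartRing q K :=
  Ideal.quotientMapₐ (Ideal.span {dehomogenize K (hermitianPoly q K)}) (dehomogenize K) (by
    rw [Ideal.span_singleton_le_iff_mem]
    exact Ideal.subset_span (Set.mem_singleton _))

/-- The maximal ideal of the point at infinity in the coordinate ring of the chart. -/
noncomputable def maxIdealInf : Ideal (ChartRing q K) :=
  Ideal.span {Ideal.Quotient.mk _ (X 0), Ideal.Quotient.mk _ (X 1)}

/-- The space `H⁰(X, 𝒪_X(d)(-a P∞))` of the degree `d` forms on `X` that vanish on the scheme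
`a P∞`; this closed subscheme of `X` lies in the chart `y ≠ 0`, where its ideal is the `a`-th
power of the maximal ideal of the point at infinity. -/
noncomputable def sections (d a : ℕ) : Submodule K (CoordRing q K) :=
  formsOn q K d ⊓
    ((maxIdealInf q K ^ a).restrictScalars K).comap (toChart q K).toLinearMap

variable {K}

/-- The homogeneous coordinates `(x : y : 1)` of a point of the affine plane `z ≠ 0`. -/
noncomputable def affineRep (P : ℙ K (Fin 3 → K)) : Fin 3 → K :=
  (P.rep 2)⁻¹ • P.rep

variable {q}

theorem eval_affineRep {P : ℙ K (Fin 3 → K)} (hP : P ∈ rationalPoints q K) :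
    eval (affineRep P) (hermitianPoly q K) = 0 := by
  have h : eval P.rep (hermitianPoly q K) = 0 := hP
  simp only [hermitianPoly, affineRep, map_sub, map_add, map_mul, map_pow, eval_X,
    Pi.smul_apply, smul_eq_mul] at h ⊢
  linear_combination (P.rep 2)⁻¹ ^ (q + 1) * h

variable (q)

/-- The value of a form on `X` at a rational point, in the coordinates `(x : y : 1)`. -/
noncomputable def evalAt (P : ℙ K (Fin 3 → K)) (hP : P ∈ rationalPoints q K) :
    CoordRing q K →ₐ[K] K :=
  Ideal.Quotient.liftₐ (Ideal.span {hermitianPoly q K}) (aeval (affineRep P)) (by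
    intro f hf
    obtain ⟨g, rfl⟩ := Ideal.mem_span_singleton'.1 hf
    rw [map_mul, aeval_eq_eval, eval_affineRep hP, mul_zero])

/-- The evaluation set `B \ H`, which indexes the coordinates of the punctured code. -/
abbrev EvalSet (H : Set (ℙ K (Fin 3 → K))) : Type _ :=
  ↥(affinePoints q K \ H)

noncomputable instance [Finite K] (H : Set (ℙ K (Fin 3 → K))) : Fintype (EvalSet q H) :=
  Fintype.ofFinite _

/-- The code `C(d, a, H)` obtained evaluating `H⁰(X, 𝒪_X(d)(-a P∞))` at the points of `B \ H`. -/
noncomputable def code (d a : ℕ) (H : Set (ℙ K (Fin 3 → K))) : Submodule K (EvalSet q H → K) :=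
  (sections q K d a).map
    (LinearMap.pi fun P : EvalSet q H => (evalAt q P.1 P.2.1.1).toLinearMap)

end Curve

end HermitianCode

namespace HermitianCode

/-! ### Dual codewords and their supports. -/

section Codes

variable {K ι : Type*} [Field K] [Fintype ι]

/-! A dual codeword is a linear relation among evaluations at its support, so no form in the code
vanishes at all points of the support but one. The code contains `z * G` for every form `G` of
degree `d - 1`, because `z` vanishes at `P∞` to order at least `q ≥ a`, and every product of `d`
lines through `P∞`.

A support of at most `d` points is excluded by `z` times at most `d - 1` separating lines
(`lt_hammingNorm_of_mem_dualCode`). In a support of `d + 1` points, a line through two points with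
different `x` either contains the support, and vertical lines then separate, or misses a point, and
killing two points with one line saves a factor (`affineRep_zero_eq_of_hammingNorm_eq`).

Conversely, as `a ≥ 1`, forms in the code have no `y ^ d` term. On a line `x = c` they are
polynomials in `y` of degree below `d`, so their values at `d + 1` points satisfy a nontrivial
relation (`exists_mem_dualCode_of_affineRep_zero_eq`). -/

theorem natCast_le_minDist_iff [DecidableEq K] (C : Submodule K (ι → K)) (n : ℕ) :
    (n : ℕ∞) ≤ minDist C ↔ ∀ u ∈ C, u ≠ 0 → n ≤ hammingNorm u := by
  simp only [minDist, le_iInf_iff, Nat.cast_le]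
  constructor
  · intro h u hu hu0
    simpa using h u hu 0 C.zero_mem hu0
  · intro h v hv w hw hvw
    rw [hammingDist_eq_hammingNorm]
    exact h _ (by simpa [sub_eq_add_neg, neg_add_eq_sub] using C.sub_mem hw hv) fun h0 =>
      hvw (by simpa [neg_add_eq_zero] using h0)

/-- The code cannot separate a point of the support of a dual codeword from the rest of it. -/
theorem not_separated_of_mem_dualCode {C : Submodule K (ι → K)} {u : ι → K} (hu : u ∈ dualCode C)
    {c : ι → K} (hc : c ∈ C) {i : ι} (hi : u i ≠ 0) (hci : c i ≠ 0)
    (h : ∀ j, u j ≠ 0 → j ≠ i → c j = 0) : False := by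
  have h1 : u ⬝ᵥ c = 0 := hu c hc
  rw [dotProduct, Finset.sum_eq_single i] at h1
  · exact mul_ne_zero hi hci h1
  · intro j _ hj
    by_cases huj : u j = 0
    · simp [huj]
    · simp [h j huj hj]
  · simp

end Codes

/-! ### Affine coordinates, and the forms that give codewords. -/

section Curve

variable {q : ℕ} {K : Type*} [Field K]

theorem rep_two_ne_zero {P : ℙ K (Fin 3 → K)} (hP : P ∈ affinePoints q K) (hq : q ≠ 0) :
    P.rep 2 ≠ 0 := by
  intro h2
  have h : eval P.rep (hermitianPoly q K) = 0 := hP.1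
  simp only [hermitianPoly, map_sub, map_add, map_mul, map_pow, eval_X, h2, mul_zero,
    zero_pow hq, add_zero, zero_sub, neg_eq_zero] at h
  have h0 : P.rep 0 = 0 := by simpa using h
  apply hP.2
  rw [Set.mem_singleton_iff, ← P.mk_rep, pInf, Projectivization.mk_eq_mk_iff']
  refine ⟨P.rep 1, ?_⟩
  ext i
  fin_cases i <;> simp [h0, h2]

theorem affineRep_two {P : ℙ K (Fin 3 → K)} (hP : P.rep 2 ≠ 0) : affineRep P 2 = 1 := by
  simp [affineRep, hP]

theorem affineRep_injOn {P Q : ℙ K (Fin 3 → K)} (hP : P.rep 2 ≠ 0) (hQ : Q.rep 2 ≠ 0)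
    (h0 : affineRep P 0 = affineRep Q 0) (h1 : affineRep P 1 = affineRep Q 1) : P = Q := by
  have h : affineRep P = affineRep Q := by
    ext i
    fin_cases i
    · exact h0
    · exact h1
    · exact (affineRep_two hP).trans (affineRep_two hQ).symm
  rw [← P.mk_rep, ← Q.mk_rep, Projectivization.mk_eq_mk_iff']
  refine ⟨P.rep 2 * (Q.rep 2)⁻¹, ?_⟩
  rw [mul_smul]
  change P.rep 2 • affineRep Q = P.rep
  rw [← h, affineRep, smul_smul, mul_inv_cancel₀ hP, one_smul]

/-- The value of a form at a point `(x : y : 1)`. -/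
theorem evalAt_mk {P : ℙ K (Fin 3 → K)} (hP : P ∈ rationalPoints q K)
    (F : MvPolynomial (Fin 3) K) :
    evalAt q P hP (Ideal.Quotient.mk _ F) = eval (affineRep P) F := by
  simp [evalAt]

theorem mem_code_of_isHomogeneous {d a : ℕ} (H : Set (ℙ K (Fin 3 → K)))
    {F : MvPolynomial (Fin 3) K} (hF : F.IsHomogeneous d)
    (hFa : Ideal.Quotient.mk _ (dehomogenize K F) ∈ maxIdealInf q K ^ a) :
    (fun P : EvalSet q H => eval (affineRep P.1) F) ∈ code q d a H := by
  refine ⟨Ideal.Quotient.mk _ F, ⟨⟨F, hF, rfl⟩, hFa⟩, ?_⟩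
  ext P
  exact evalAt_mk P.2.1.1 F

/-- The coefficient of `y ^ d` is the value of the form at `(0 : 1 : 0)`, where it must vanish as
soon as `a ≠ 0`. -/
theorem exists_form_of_mem_code {d a : ℕ} (ha : a ≠ 0) {H : Set (ℙ K (Fin 3 → K))}
    {c : EvalSet q H → K} (hq : q ≠ 0) (hc : c ∈ code q d a H) :
    ∃ F : MvPolynomial (Fin 3) K, F.IsHomogeneous d ∧ coeff (Finsupp.single 1 d) F = 0 ∧
      ∀ P, c P = eval (affineRep P.1) F := by
  obtain ⟨_, ⟨⟨F, hF, rfl⟩, hFa⟩, rfl⟩ := hc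
  refine ⟨F, hF, ?_, fun P => evalAt_mk P.2.1.1 F⟩
  -- Evaluation at the origin of the chart, that is, at `P∞`.
  let φ : ChartRing q K →ₐ[K] K :=
    Ideal.Quotient.liftₐ _ (aeval (0 : Fin 2 → K)) (by
      intro f hf
      obtain ⟨g, rfl⟩ := Ideal.mem_span_singleton'.1 hf
      simp [dehomogenize, hermitianPoly, hq])
  have hφ : ∀ x ∈ maxIdealInf q K, φ x = 0 := by
    intro x hx
    have : maxIdealInf q K ≤ RingHom.ker φ := by
      rw [maxIdealInf, Ideal.span_le]
      rintro x (rfl | rfl) <;> simp [φ, RingHom.mem_ker]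
    exact this hx
  have h0 : φ (Ideal.Quotient.mk _ (dehomogenize K F)) = 0 :=
    hφ _ (Ideal.pow_le_self ha hFa)
  have h1 : φ (Ideal.Quotient.mk _ (dehomogenize K F)) = eval ![0, 1, 0] F := by
    change aeval (0 : Fin 2 → K) (aeval _ F) = _
    rw [← AlgHom.comp_apply, comp_aeval, ← aeval_eq_eval]
    congr 2
    ext i
    fin_cases i <;> simp
  rw [h1, eval_eq', Finset.sum_eq_single (Finsupp.single 1 d)] at h0
  · simpa [Fin.prod_univ_three] using h0
  · intro m hm hmd
    have hdeg : m.degree = d := by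
      rw [Finsupp.degree_eq_weight_one]
      exact hF (mem_support_iff.1 hm)
    rw [Finsupp.degree_eq_sum, Fin.sum_univ_three] at hdeg
    have : m 0 ≠ 0 ∨ m 2 ≠ 0 := by
      by_contra! h
      apply hmd
      ext i
      fin_cases i <;> simp [h.1, h.2] at hdeg ⊢
      exact hdeg
    rcases this with h | h <;> simp [Fin.prod_univ_three, h]
  · intro hm
    simp [notMem_support_iff.1 hm]

theorem dehomogenize_hermitianPoly :
    dehomogenize K (hermitianPoly q K) = X 1 + X 1 ^ q - X 0 ^ (q + 1) := by
  simp [dehomogenize, hermitianPoly]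

theorem dehomogenize_X_zero : dehomogenize K (X 0) = X 0 := by simp [dehomogenize]

theorem dehomogenize_X_two : dehomogenize K (X 2) = X 1 := by simp [dehomogenize]

theorem mk_X_zero_mem : Ideal.Quotient.mk _ (X 0) ∈ maxIdealInf q K :=
  Ideal.subset_span (by simp)

theorem mk_X_one_mem : Ideal.Quotient.mk _ (X 1) ∈ maxIdealInf q K :=
  Ideal.subset_span (by simp)

/-- The line `z = 0` meets the curve at the point at infinity with multiplicity at least `q`. -/
theorem mk_X_one_mem_pow {a : ℕ} (haq : a ≤ q) :
    Ideal.Quotient.mk _ (X 1) ∈ maxIdealInf q K ^ a := by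
  apply Ideal.pow_le_pow_right haq
  have h : (Ideal.Quotient.mk (Ideal.span {dehomogenize K (hermitianPoly q K)}))
      (X 1 + X 1 ^ q - X 0 ^ (q + 1)) = 0 := by
    rw [Ideal.Quotient.eq_zero_iff_mem, ← dehomogenize_hermitianPoly]
    exact Ideal.subset_span rfl
  -- On the curve `w = u ^ (q + 1) - w ^ q`, and both terms lie in the `q`-th power of the ideal.
  rw [map_sub, map_add, map_pow, map_pow, sub_eq_zero, ← eq_sub_iff_add_eq] at h
  rw [h]
  exact sub_mem (Ideal.pow_le_pow_right q.le_succ (Ideal.pow_mem_pow mk_X_zero_mem _))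
    (Ideal.pow_mem_pow mk_X_one_mem _)

/-- The code contains the evaluations of all affine polynomials of degree less than `d`. -/
theorem mem_code_X_two_mul {d a : ℕ} (haq : a ≤ q) (H : Set (ℙ K (Fin 3 → K)))
    {F : MvPolynomial (Fin 3) K} (hF : (X 2 * F).IsHomogeneous d) :
    (fun P : EvalSet q H => eval (affineRep P.1) (X 2 * F)) ∈ code q d a H := by
  apply mem_code_of_isHomogeneous H hF
  rw [map_mul, map_mul, dehomogenize_X_two]
  exact Ideal.mul_mem_right _ _ (mk_X_one_mem_pow haq)

theorem isHomogeneous_C_mul_X_sub (c e : K) (i j : Fin 3) :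
    (C c * X i - C e * X j : MvPolynomial (Fin 3) K).IsHomogeneous 1 :=
  (isHomogeneous_C_mul_X c i).sub (isHomogeneous_C_mul_X e j)

/-- The code contains the evaluations of products of `d` lines through the point at infinity. -/
theorem mem_code_prod_vertical {d a : ℕ} (had : a ≤ d) (H : Set (ℙ K (Fin 3 → K)))
    {ι : Type*} (s : Finset ι) (hs : s.card = d) (x : ι → K) :
    (fun P : EvalSet q H => eval (affineRep P.1) (∏ i ∈ s, (C 1 * X 0 - C (x i) * X 2)))
      ∈ code q d a H := by
  apply mem_code_of_isHomogeneous H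
  · have := IsHomogeneous.prod s (fun i => (C 1 * X 0 - C (x i) * X 2 : MvPolynomial (Fin 3) K))
      (fun _ => 1) fun i _ => isHomogeneous_C_mul_X_sub 1 (x i) 0 2
    simpa [hs] using this
  · rw [map_prod, map_prod]
    apply Ideal.pow_le_pow_right had
    have hprod : ∏ i ∈ s, maxIdealInf q K = maxIdealInf q K ^ d := by rw [Finset.prod_const, hs]
    rw [← hprod]
    apply Ideal.prod_mem_prod
    intro i _
    simp only [map_sub, map_mul, dehomogenize_X_zero, dehomogenize_X_two]
    exact sub_mem (Ideal.mul_mem_left _ _ mk_X_zero_mem) (Ideal.mul_mem_left _ _ mk_X_one_mem)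

/-- Distinct affine points are separated by a line. -/
theorem exists_line_separating {P Q : ℙ K (Fin 3 → K)} (hP : P.rep 2 ≠ 0) (hQ : Q.rep 2 ≠ 0)
    (hPQ : P ≠ Q) : ∃ F : MvPolynomial (Fin 3) K, F.IsHomogeneous 1 ∧
      eval (affineRep P) F ≠ 0 ∧ eval (affineRep Q) F = 0 := by
  by_cases h0 : affineRep P 0 = affineRep Q 0
  · refine ⟨_, isHomogeneous_C_mul_X_sub 1 (affineRep Q 1) 1 2, ?_, ?_⟩
    · simpa [affineRep_two hP, sub_eq_zero] using fun h1 => hPQ (affineRep_injOn hP hQ h0 h1)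
    · simp [affineRep_two hQ]
  · refine ⟨_, isHomogeneous_C_mul_X_sub 1 (affineRep Q 0) 0 2, ?_, ?_⟩
    · simpa [affineRep_two hP, sub_eq_zero] using h0
    · simp [affineRep_two hQ]

/-- An affine point is separated from finitely many others by as many lines. -/
theorem exists_form_separating {ι : Type*} (s : Finset ι) (p : ι → ℙ K (Fin 3 → K))
    {P : ℙ K (Fin 3 → K)} (hP : P.rep 2 ≠ 0) (hs : ∀ i ∈ s, (p i).rep 2 ≠ 0 ∧ P ≠ p i) :
    ∃ F : MvPolynomial (Fin 3) K, F.IsHomogeneous s.card ∧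
      eval (affineRep P) F ≠ 0 ∧ ∀ i ∈ s, eval (affineRep (p i)) F = 0 := by
  choose! F hF using fun i (hi : i ∈ s) => exists_line_separating hP (hs i hi).1 (hs i hi).2
  refine ⟨∏ i ∈ s, F i, ?_, ?_, ?_⟩
  · simpa using IsHomogeneous.prod s F (fun _ => 1) fun i hi => (hF i hi).1
  · rw [map_prod]
    exact Finset.prod_ne_zero_iff.2 fun i hi => (hF i hi).2.1
  · intro i hi
    rw [map_prod]
    exact Finset.prod_eq_zero hi (hF i hi).2.2

theorem EvalSet.rep_two_ne_zero {H : Set (ℙ K (Fin 3 → K))} (hq : q ≠ 0) (P : EvalSet q H) :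
    P.1.rep 2 ≠ 0 :=
  HermitianCode.rep_two_ne_zero P.2.1 hq

/-! ### Dual codewords of small weight. -/

variable [Finite K]

theorem lt_hammingNorm_of_mem_dualCode [DecidableEq K] {d a : ℕ} (hdq : d < q)
    (had : a ≤ d) {H : Set (ℙ K (Fin 3 → K))} {u : EvalSet q H → K}
    (hu : u ∈ dualCode (code q d a H)) (hu0 : u ≠ 0) : d + 1 ≤ hammingNorm u := by
  classical
  by_contra! hlt
  obtain ⟨P, hP⟩ := Function.ne_iff.1 hu0
  set T : Finset (EvalSet q H) := Finset.univ.filter fun P => u P ≠ 0 with hT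
  have hPT : P ∈ T := by simpa [hT] using hP
  have hTd : T.card ≤ d := by
    have : T.card = hammingNorm u := rfl
    omega
  have hq0 : q ≠ 0 := by omega
  have hrep := EvalSet.rep_two_ne_zero (H := H) hq0
  obtain ⟨F, hF, hFP, hFT⟩ := exists_form_separating (T.erase P) (fun Q => Q.1) (hrep P)
    fun Q hQ => ⟨hrep Q, fun h => (Finset.ne_of_mem_erase hQ) (Subtype.ext h.symm)⟩
  have hcard := Finset.card_erase_add_one hPT
  -- The power of `z` pads the degree, `1 + (d - |T|) + (|T| - 1) = d`, and equals `1` at affine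
  -- points.
  have hhom : (X 2 * (X 2 ^ (d - T.card) * F)).IsHomogeneous d := by
    have := (isHomogeneous_X K (2 : Fin 3)).mul
      (((isHomogeneous_X K (2 : Fin 3)).pow (d - T.card)).mul hF)
    convert this using 1
    omega
  refine not_separated_of_mem_dualCode hu (mem_code_X_two_mul (by omega) H hhom) (i := P) hP ?_ ?_
  · simpa [affineRep_two (hrep P)] using hFP
  · intro Q hQ hQP
    have hmem : Q ∈ T.erase P := Finset.mem_erase.2 ⟨hQP, by simpa [hT] using hQ⟩
    simp [hFT Q hmem]

theorem affineRep_zero_eq_of_hammingNorm_eq [DecidableEq K] {d a : ℕ} (hdq : d < q)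
    (had : a ≤ d) {H : Set (ℙ K (Fin 3 → K))} {u : EvalSet q H → K}
    (hu : u ∈ dualCode (code q d a H)) (hud : hammingNorm u = d + 1)
    {Q R : EvalSet q H} (hQ : u Q ≠ 0) (hR : u R ≠ 0) :
    affineRep Q.1 0 = affineRep R.1 0 := by
  classical
  by_contra hQR
  set T : Finset (EvalSet q H) := Finset.univ.filter fun P => u P ≠ 0 with hT
  have hTd : T.card = d + 1 := hud
  have memT : ∀ {P}, P ∈ T ↔ u P ≠ 0 := by simp [hT]
  have hq0 : q ≠ 0 := by omega
  have hrep := EvalSet.rep_two_ne_zero (H := H) hq0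
  have hne : R ≠ Q := fun h => hQR (by rw [h])
  let x : EvalSet q H → K := fun P => affineRep P.1 0
  let y : EvalSet q H → K := fun P => affineRep P.1 1
  -- The equation of the line through `Q` and `R`.
  let L : MvPolynomial (Fin 3) K :=
    C (x R - x Q) * (C 1 * X 1 - C (y Q) * X 2) - C (y R - y Q) * (C 1 * X 0 - C (x Q) * X 2)
  have hL1 : L.IsHomogeneous 1 :=
    ((isHomogeneous_C_mul_X_sub 1 (y Q) 1 2).C_mul _).sub
      ((isHomogeneous_C_mul_X_sub 1 (x Q) 0 2).C_mul _)
  have hL : ∀ P : EvalSet q H, eval (affineRep P.1) L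
      = (x R - x Q) * (y P - y Q) - (y R - y Q) * (x P - x Q) := by
    intro P
    simp [L, x, y, affineRep_two (hrep P)]
  by_cases hcol : ∀ P ∈ T, eval (affineRep P.1) L = 0
  -- This line is not vertical, so no other point of `T` shares the `x`-coordinate of `Q`.
  · have hcard : (T.erase Q).card = d := by
      rw [Finset.card_erase_of_mem (memT.2 hQ), hTd, Nat.add_sub_cancel]
    refine not_separated_of_mem_dualCode hu (mem_code_prod_vertical had H (T.erase Q) hcard x)
      (i := Q) hQ ?_ ?_
    · rw [map_prod]
      refine Finset.prod_ne_zero_iff.2 fun P hP h => ?_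
      obtain ⟨hPQ, hPT⟩ := Finset.mem_erase.1 hP
      have hx : x Q = x P := by simpa [affineRep_two (hrep Q), sub_eq_zero] using h
      have h2 := hcol P hPT
      rw [hL, hx, sub_self, mul_zero, sub_zero, mul_eq_zero, sub_eq_zero, sub_eq_zero, ← hx] at h2
      rcases h2 with h2 | h2
      · exact hQR h2.symm
      · exact hPQ (Subtype.ext (affineRep_injOn (hrep P) (hrep Q) hx.symm h2))
    · intro P hP hPQ
      rw [map_prod]
      refine Finset.prod_eq_zero (Finset.mem_erase.2 ⟨hPQ, memT.2 hP⟩) ?_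
      simp [x, affineRep_two (hrep P)]
  · push Not at hcol
    obtain ⟨P, hPT, hPL⟩ := hcol
    have hPQ : P ≠ Q := by
      rintro rfl
      exact hPL (by rw [hL]; ring)
    have hPR : P ≠ R := by
      rintro rfl
      exact hPL (by rw [hL]; ring)
    -- `L` already kills `Q` and `R`; the other `d - 2` points need one line each, which leaves room
    -- for the factor `z`.
    obtain ⟨F, hF, hFP, hFT⟩ := exists_form_separating (((T.erase P).erase Q).erase R)
      (fun Q => Q.1) (hrep P) fun S hS => ⟨hrep S, fun h => by
        have := Subtype.ext h
        simp [← this] at hS⟩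
    have hQm : Q ∈ T.erase P := Finset.mem_erase.2 ⟨hPQ.symm, memT.2 hQ⟩
    have hRm : R ∈ (T.erase P).erase Q :=
      Finset.mem_erase.2 ⟨hne, Finset.mem_erase.2 ⟨hPR.symm, memT.2 hR⟩⟩
    have h1 := Finset.card_erase_add_one hPT
    have h2 := Finset.card_erase_add_one hQm
    have h3 := Finset.card_erase_add_one hRm
    have hhom : (X 2 * (L * F)).IsHomogeneous d := by
      have := (isHomogeneous_X K (2 : Fin 3)).mul (hL1.mul hF)
      convert this using 1
      omega
    refine not_separated_of_mem_dualCode hu (mem_code_X_two_mul (by omega) H hhom)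
      (i := P) (memT.1 hPT) ?_ ?_
    · simpa [affineRep_two (hrep P)] using ⟨hPL, hFP⟩
    · intro S hS hSP
      rw [map_mul, map_mul]
      by_cases hSQ : S = Q
      · rw [hL, hSQ]; ring
      by_cases hSR : S = R
      · rw [hL, hSR]; ring
      rw [hFT S (by simp [hSR, hSQ, hSP, memT.2 hS])]
      ring

theorem exists_mem_dualCode_of_affineRep_zero_eq [DecidableEq K] {d a : ℕ} (ha : a ≠ 0)
    (hq : q ≠ 0) {H : Set (ℙ K (Fin 3 → K))} (T : Finset (EvalSet q H)) (hT : T.card = d + 1)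
    (c : K) (hc : ∀ P ∈ T, affineRep P.1 0 = c) :
    ∃ u ∈ dualCode (code q d a H), u ≠ 0 ∧ hammingNorm u ≤ d + 1 := by
  classical
  -- Orthogonality to `1, y, ..., y ^ (d - 1)`: `d` equations in `d + 1` unknowns.
  let M : (T → K) →ₗ[K] (Fin d → K) :=
    LinearMap.pi fun j => ∑ P : T, (affineRep P.1.1 1) ^ (j : ℕ) • LinearMap.proj P
  have hM : LinearMap.ker M ≠ ⊥ := LinearMap.ker_ne_bot_of_finrank_lt (by simp [hT])
  obtain ⟨v, hv, hv0⟩ := Submodule.exists_mem_ne_zero_of_ne_bot hM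
  have hvj : ∀ j < d, ∑ P : T, affineRep P.1.1 1 ^ j * v P = 0 := by
    intro j hj
    simpa [M] using congrFun (LinearMap.mem_ker.1 hv) ⟨j, hj⟩
  let u : EvalSet q H → K := fun P => if h : P ∈ T then v ⟨P, h⟩ else 0
  have huT : ∀ P : T, u P = v P := fun P => by simp [u]
  have hsum : ∀ g : EvalSet q H → K, u ⬝ᵥ g = ∑ P : T, v P * g P := by
    intro g
    rw [dotProduct, ← Finset.sum_subset T.subset_univ, ← Finset.sum_coe_sort]
    · simp only [huT]
    · intro P _ hP
      simp [u, hP]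
  refine ⟨u, ?_, ?_, ?_⟩
  · intro g hg
    obtain ⟨F, hF, hFd, hFg⟩ := exists_form_of_mem_code ha hq hg
    rw [hsum]
    simp only [hFg, eval_eq', Finset.mul_sum]
    rw [Finset.sum_comm]
    refine Finset.sum_eq_zero fun m hm => ?_
    have hdeg : m.degree = d := by
      rw [Finsupp.degree_eq_weight_one]
      exact hF (mem_support_iff.1 hm)
    rw [Finsupp.degree_eq_sum, Fin.sum_univ_three] at hdeg
    -- The only monomial of degree `d` with `y`-exponent at least `d` is `y ^ d`, whose coefficient
    -- is zero.
    have hlt : m 1 < d := by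
      by_contra! h
      apply mem_support_iff.1 hm
      convert hFd
      ext i
      fin_cases i <;> simp <;> omega
    rw [← mul_zero (coeff m F * c ^ m 0), ← hvj _ hlt, Finset.mul_sum]
    refine Finset.sum_congr rfl fun P _ => ?_
    rw [Fin.prod_univ_three, hc P P.2, affineRep_two (EvalSet.rep_two_ne_zero hq P.1)]
    ring
  · intro h
    apply hv0
    ext P
    rw [← huT, h]
    rfl
  · rw [← hT]
    refine Finset.card_le_card fun P hP => ?_
    by_contra h
    simp [u, h] at hP

/-! ### Lines in affine coordinates. -/

omit [Finite K] in
theorem pInf_mem_line_iff (L : ℙ K (Fin 3 → K)) : pInf K ∈ line L ↔ L.rep 1 = 0 := by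
  rw [line, Set.mem_ofPred_eq, ← L.mk_rep, pInf, Projectivization.orthogonal_mk, L.mk_rep]
  simp [dotProduct, Fin.sum_univ_three]

omit [Finite K] in
theorem mem_line_iff {P : ℙ K (Fin 3 → K)} (hP : P.rep 2 ≠ 0) {v : Fin 3 → K} (hv : v ≠ 0) :
    P ∈ line (Projectivization.mk K v hv) ↔
      affineRep P 0 * v 0 + affineRep P 1 * v 1 + v 2 = 0 := by
  rw [line, Set.mem_ofPred_eq]
  nth_rw 1 [← P.mk_rep]
  rw [Projectivization.orthogonal_mk]
  simp only [dotProduct, Fin.sum_univ_three, affineRep, Pi.smul_apply, smul_eq_mul]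
  rw [← mul_right_inj' (inv_ne_zero hP), mul_zero]
  refine iff_of_eq (congrArg (· = 0) ?_)
  field_simp

end Curve

end HermitianCode

open HermitianCode

theorem theorem6p4 (q : ℕ) (hq : IsPrimePow q) {K : Type*} [Field K] [Fintype K] [DecidableEq K]
    (hK : Fintype.card K = q ^ 2) (d a : ℕ) (hd : 0 < d) (hdq : d < q) (ha : 1 ≤ a) (had : a ≤ d)
    (H : Set (ℙ K (Fin 3 → K))) (hH : H.Nonempty) (hHB : H ⊆ HermitianCode.affinePoints q K) :
    ((d + 1 : ℕ) : ℕ∞) ≤ HermitianCode.minDist (HermitianCode.dualCode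
        (HermitianCode.code q d a H)) ∧
    (HermitianCode.minDist (HermitianCode.dualCode (HermitianCode.code q d a H)) =
        ((d + 1 : ℕ) : ℕ∞) ↔
      ∃ S : Finset (ℙ K (Fin 3 → K)), (S : Set (ℙ K (Fin 3 → K))) ⊆
          HermitianCode.affinePoints q K \ H ∧ S.card = d + 1 ∧
        ∃ L : ℙ K (Fin 3 → K), HermitianCode.pInf K ∈ HermitianCode.line L ∧
          (S : Set (ℙ K (Fin 3 → K))) ⊆ HermitianCode.line L) := by

  classical
  have hq0 : q ≠ 0 := by omega
  have hlow : ((d + 1 : ℕ) : ℕ∞) ≤ minDist (dualCode (code q d a H)) :=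
    (natCast_le_minDist_iff _ _).2 fun u hu hu0 =>
      lt_hammingNorm_of_mem_dualCode hdq had hu hu0
  refine ⟨hlow, fun heq => ?_, ?_⟩
  · have hnot : ¬ ((d + 2 : ℕ) : ℕ∞) ≤ minDist (dualCode (code q d a H)) := by
      rw [heq, Nat.cast_le]
      omega
    rw [natCast_le_minDist_iff] at hnot
    push Not at hnot
    obtain ⟨u, hu, hu0, hlt⟩ := hnot
    have hud : hammingNorm u = d + 1 := by
      have := lt_hammingNorm_of_mem_dualCode hdq had hu hu0
      omega
    obtain ⟨Q, hQ⟩ := Function.ne_iff.1 hu0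
    refine ⟨(Finset.univ.filter fun P => u P ≠ 0).map (Function.Embedding.subtype _), ?_, ?_,
      -- The vertical line through `Q`.
      Projectivization.mk K ![1, 0, -affineRep Q.1 0] (fun h => one_ne_zero (congrFun h 0)), ?_, ?_⟩
    · intro P hP
      simp only [Finset.coe_map, Set.mem_image] at hP
      obtain ⟨P, -, rfl⟩ := hP
      exact P.2
    · rw [Finset.card_map]
      exact hud
    · rw [line, Set.mem_ofPred_eq, pInf, Projectivization.orthogonal_mk]
      simp [dotProduct, Fin.sum_univ_three]
    · intro P hP
      simp only [Finset.coe_map, Set.mem_image] at hP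
      obtain ⟨P, hP, rfl⟩ := hP
      have hPu : u P ≠ 0 := by simpa using hP
      have := affineRep_zero_eq_of_hammingNorm_eq hdq had hu hud hPu hQ
      exact (mem_line_iff (EvalSet.rep_two_ne_zero hq0 P) _).2 (by simp [this])
  · rintro ⟨S, hSB, hS, L, hL, hSL⟩
    have hL1 := (pInf_mem_line_iff L).1 hL
    have hx : ∀ P ∈ S, affineRep P 0 = -L.rep 2 / L.rep 0 := by
      intro P hP
      have h := hSL hP
      rw [← L.mk_rep, mem_line_iff (rep_two_ne_zero (hSB hP).1 hq0), hL1, mul_zero, add_zero] at h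
      -- Otherwise `L` would be the line `z = 0`, which contains no affine point.
      have h0 : L.rep 0 ≠ 0 := by
        intro h0
        rw [h0, mul_zero, zero_add] at h
        apply L.rep_nonzero
        ext i
        fin_cases i <;> simp [h0, hL1, h]
      rw [eq_div_iff h0]
      linear_combination h
    obtain ⟨u, hu, hu0, hud⟩ := exists_mem_dualCode_of_affineRep_zero_eq (d := d) (a := a) (H := H)
      (by omega) hq0 (S.subtype (· ∈ affinePoints q K \ H)) (by
        rw [Finset.card_subtype, Finset.filter_true_of_mem fun P hP => hSB hP, hS])
      _ (fun P hP => hx P (by simpa using hP))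
    refine le_antisymm ?_ hlow
    by_contra! hlt
    have hle : ((d + 2 : ℕ) : ℕ∞) ≤ minDist (dualCode (code q d a H)) := by
      have := Order.add_one_le_of_lt hlt
      exact_mod_cast this
    have := (natCast_le_minDist_iff _ _).1 hle u hu hu0
    omega
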